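/- For $d\ge 1$ let $S=\{x\in\mathbb{R}^d:\|x\|=1\}$ be the Euclidean unit sphere of $\mathbb{R}^d$. A (possibly randomized) compression operator $\mathcal{C}\colon S\to\mathbb{R}^d$ is a composition $\mathcal{C}(x)=D(E(x))$ of a (possibly randomized) encoder $E$, which maps each $x\in S$ to a finite binary word $E(x)\in\{0,1\}^*$, and a decoder $D\colon\{0,1\}^*\to\mathbb{R}^d$. It is $\alpha$-contractive if $\mathbb{E}\,\|\mathcal{C}(x)-x\|^2\le\alpha\|x\|^2$ for every $x\in S$. Its worst-case number of bits $b$ is the supremum of the lengths $|E(x)|$ over all $x\in S$ and all realizations of the randomness. **Theorem.** Let $\alpha\in(0,1)$. For every $d\ge 3$ there is an $\alpha$-contractive compression operator $\mathcal{C}_d\colon S\to\mathbb{R}^d$ on the unit sphere of $\mathbb{R}^d$ whose worst-case number of bits $b_d$ is finite and satisfies $$\alpha\,4^{b_d/d}\le\left(1600\,d^2\log_2 d\right)^{2/d}.$$ In particular, for every $\epsilon>0$ these operators satisfy $\alpha\,4^{b_d/d}<1+\epsilon$ for all sufficiently large $d$. -/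

import Mathlib

open MeasureTheory

/-- The unit sphere `{x ∈ ℝ^d : ‖x‖ = 1}` of Euclidean space `ℝ^d`. -/
abbrev UnitSphere (d : ℕ) : Type :=
  Metric.sphere (0 : EuclideanSpace ℝ (Fin d)) 1

/-- A (possibly randomized) compression operator on the unit sphere of `ℝ^d`, given together with
its encoder and decoder. The randomness is that of a probability space `(Ω, P)`: the unit vector
`x` is encoded, for the realization `ω`, by the finite binary word `encode x ω`, and the receiver
recovers the compressed vector from that word alone. A deterministic operator is the case in which
`Ω` is a point. -/
structure SphereCompressor (d : ℕ) where
  Ω : Type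
  mΩ : MeasurableSpace Ω
  P : Measure Ω
  isProbabilityMeasure : IsProbabilityMeasure P
  encode : UnitSphere d → Ω → List Bool
  decode : List Bool → EuclideanSpace ℝ (Fin d)
  /-- For each `x` the codeword is a (discrete) random variable. -/
  measurableSet_encode : ∀ x w, MeasurableSet {ω | encode x ω = w}

namespace SphereCompressor

/-- The operator itself: the compressed vector `C(x) = D(E(x))`, a random vector of `ℝ^d`. -/
def toFun {d : ℕ} (C : SphereCompressor d) (x : UnitSphere d) (ω : C.Ω) :
    EuclideanSpace ℝ (Fin d) :=
  C.decode (C.encode x ω)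

/-- `C` is `α`-contractive: `𝔼 ‖C(x) - x‖² ≤ α ‖x‖²` for every unit vector `x`. -/
def IsContractive {d : ℕ} (C : SphereCompressor d) (α : ℝ) : Prop :=
  letI := C.mΩ
  ∀ x : UnitSphere d,
    Integrable (fun ω => ‖C.toFun x ω - x‖ ^ 2) C.P ∧
      ∫ ω, ‖C.toFun x ω - x‖ ^ 2 ∂C.P ≤ α * ‖(x : EuclideanSpace ℝ (Fin d))‖ ^ 2

/-- The worst-case number of bits: the supremum of the codeword lengths, over all unit vectors
and all realizations. It is `⊤` if the lengths are unbounded. -/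
noncomputable def worstCaseBits {d : ℕ} (C : SphereCompressor d) : ℕ∞ :=
  ⨆ (x : UnitSphere d) (ω : C.Ω), ((C.encode x ω).length : ℕ∞)

end SphereCompressor

/-! A cover of the sphere by at most `2 ^ b` balls of radius `r = √α` is a deterministic compressor:
the word names a centre near `x`. Since `α * 4 ^ (b / d) = (r ^ d * 2 ^ b) ^ (2 / d)`, a cover of
size polynomial in `d` times `r⁻ᵈ` suffices: the `2 / d`-th power of the polynomial factor tends to
1.

Centres are sampled uniformly from the ball of radius `(1 + θ) * ρ` with `r ^ 2 + ρ ^ 2 = 1`. By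
`measureReal_inter_closedBall_ge`, a sample lies within `(1 + θ) * r` of a given unit vector with
probability at least `p = θ * (r / (1 + θ)) ^ d`. Greedy choice of `n` centres leaves at most a
fraction `(1 - p) ^ n` of a fine net uncovered; the leftover net points become centres themselves.
With `θ = 1 / (4 * d)` the enlargements cost only a constant factor. -/

section Geometry

/-! ### Volume estimates: intersecting balls and sphere nets. -/

open Module Metric Set
open scoped RealInnerProductSpace

variable {E : Type*} [NormedAddCommGroup E] [InnerProductSpace ℝ E]

/-- The linear map with eigenvalue `h` on the line spanned by a unit vector `x` and eigenvalue `a`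
on its orthogonal complement. -/
noncomputable def axialScaling (x : E) (a h : ℝ) : E →ₗ[ℝ] E :=
  a • LinearMap.transvection (innerₛₗ ℝ x) ((h / a - 1) • x)

lemma axialScaling_apply (x : E) {a : ℝ} (ha : a ≠ 0) (h : ℝ) (u : E) :
    axialScaling x a h u = a • u + ((h - a) * ⟪x, u⟫) • x := by
  simp only [axialScaling, LinearMap.smul_apply, LinearMap.transvection.apply, innerₛₗ_apply_apply,
    smul_add, smul_smul]
  congr 2
  field_simp

lemma det_axialScaling [FiniteDimensional ℝ E] {x : E} (hx : ‖x‖ = 1) (a h : ℝ) :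
    LinearMap.det (axialScaling x a h) = a ^ finrank ℝ E * (h / a) := by
  simp only [axialScaling, LinearMap.det_smul, LinearMap.transvection.det, map_smul,
    innerₛₗ_apply_apply, real_inner_self_eq_norm_sq, hx]
  simp

/-- The component along `x` is at most `|t| + h` in size and the orthogonal one at most `a`;
Pythagoras. -/
lemma norm_sq_add_axialScaling_le {x : E} (hx : ‖x‖ = 1) {a h : ℝ} (ha : 0 < a) (hh : 0 ≤ h)
    {u : E} (hu : ‖u‖ ≤ 1) (t : ℝ) :
    ‖t • x + axialScaling x a h u‖ ^ 2 ≤ (|t| + h) ^ 2 + a ^ 2 := by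
  have hβ : |⟪x, u⟫| ≤ 1 := by
    have := abs_real_inner_le_norm x u
    rw [hx, one_mul] at this
    exact this.trans hu
  have hexp : ‖t • x + axialScaling x a h u‖ ^ 2 =
      (t + h * ⟪x, u⟫) ^ 2 + a ^ 2 * (‖u‖ ^ 2 - ⟪x, u⟫ ^ 2) := by
    rw [axialScaling_apply x ha.ne',
      show t • x + (a • u + ((h - a) * ⟪x, u⟫) • x) = (t + (h - a) * ⟪x, u⟫) • x + a • u by
        module,
      norm_add_sq_real, norm_smul, norm_smul, inner_smul_left, inner_smul_right, hx, mul_one,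
      mul_pow, Real.norm_eq_abs, Real.norm_eq_abs, sq_abs, sq_abs]
    simp only [conj_trivial]
    ring
  rw [hexp]
  have h1 : (t + h * ⟪x, u⟫) ^ 2 ≤ (|t| + h) ^ 2 := by
    refine sq_le_sq.2 ?_
    rw [abs_of_nonneg (a := |t| + h) (by positivity)]
    refine (abs_add_le _ _).trans ?_
    rw [abs_mul, abs_of_nonneg hh]
    nlinarith
  have h2 : ‖u‖ ^ 2 - ⟪x, u⟫ ^ 2 ≤ 1 := by nlinarith [norm_nonneg u, sq_nonneg ⟪x, u⟫]
  nlinarith [sq_nonneg a]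

/-- Two balls whose boundaries cross orthogonally, enlarged by the factor `1 + κ`, have a large
common part: it contains an ellipsoid. -/
lemma measureReal_inter_closedBall_ge [FiniteDimensional ℝ E] [MeasurableSpace E] [BorelSpace E]
    (μ : Measure E) [μ.IsAddHaarMeasure] {x : E} (hx : ‖x‖ = 1) {r ρ κ : ℝ} (hr : 0 < r)
    (hρ : 0 < ρ) (hrρ : r ^ 2 + ρ ^ 2 = 1) (hκ : 0 < κ) :
    κ * (r * ρ) ^ finrank ℝ E * μ.real (closedBall 0 1) ≤
      μ.real (closedBall 0 ((1 + κ) * ρ) ∩ closedBall x ((1 + κ) * r)) := by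
  have hr1 : r ≤ 1 := by nlinarith
  have hρ1 : ρ ≤ 1 := by nlinarith
  set T := axialScaling x (r * ρ) (κ * (r * ρ)) with hT
  have ha : 0 < r * ρ := by positivity
  have hh : 0 ≤ κ * (r * ρ) := by positivity
  -- The spheres of radius `ρ` about 0 and `r` about `x` meet in a sphere of radius `r * ρ` centred
  -- at `ρ ^ 2 • x`. The ellipsoid has that centre, that radius across the axis, and semi-axis `κ *
  -- (r * ρ)` along it.
  have hsub : (fun v => (ρ ^ 2) • x + v) '' (T '' closedBall 0 1) ⊆
      closedBall 0 ((1 + κ) * ρ) ∩ closedBall x ((1 + κ) * r) := by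
    rintro _ ⟨_, ⟨u, hu, rfl⟩, rfl⟩
    have hu : ‖u‖ ≤ 1 := by simpa using hu
    have hκrρ : κ * (r * ρ) ≤ κ * r ∧ κ * (r * ρ) ≤ κ * ρ := by
      constructor <;> gcongr <;> nlinarith
    constructor
    · rw [mem_closedBall_zero_iff]
      refine le_of_sq_le_sq ?_ (by positivity)
      refine (norm_sq_add_axialScaling_le hx ha hh hu _).trans ?_
      rw [abs_of_nonneg (by positivity)]
      have : (ρ ^ 2 + κ * (r * ρ)) ^ 2 + (r * ρ) ^ 2 =
          ρ ^ 2 * (1 + 2 * (κ * (r * ρ)) + (κ * r) ^ 2) := by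
        linear_combination (ρ ^ 2) * hrρ
      rw [this, mul_pow (1 + κ), mul_comm ((1 + κ) ^ 2)]
      gcongr
      nlinarith [mul_pos hκ hr]
    · rw [mem_closedBall, dist_eq_norm,
        show (ρ ^ 2) • x + T u - x = (-(r ^ 2)) • x + T u by
          rw [show ρ ^ 2 = 1 - r ^ 2 by linarith]; module]
      refine le_of_sq_le_sq ?_ (by positivity)
      refine (norm_sq_add_axialScaling_le hx ha hh hu _).trans ?_
      rw [abs_neg, abs_of_nonneg (by positivity)]
      have : (r ^ 2 + κ * (r * ρ)) ^ 2 + (r * ρ) ^ 2 =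
          r ^ 2 * (1 + 2 * (κ * (r * ρ)) + (κ * ρ) ^ 2) := by
        linear_combination (r ^ 2) * hrρ
      rw [this, mul_pow (1 + κ), mul_comm ((1 + κ) ^ 2)]
      gcongr
      nlinarith [mul_pos hκ hρ]
  have hvol : μ.real ((fun v => (ρ ^ 2) • x + v) '' (T '' closedBall 0 1)) =
      κ * (r * ρ) ^ finrank ℝ E * μ.real (closedBall 0 1) := by
    rw [measureReal_def, image_add_left, measure_preimage_add, Measure.addHaar_image_linearMap,
      hT, det_axialScaling hx, mul_div_cancel_right₀ _ ha.ne', abs_of_nonneg (by positivity),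
      ENNReal.toReal_mul, ENNReal.toReal_ofReal (by positivity), ← measureReal_def]
    ring
  rw [← hvol]
  exact measureReal_mono hsub
    (((isCompact_closedBall _ _).inter_right isClosed_closedBall).measure_lt_top.ne)

/-- Packing by volume: the balls of radius `η` about the points are disjoint and lie in a ball of
radius `1 + η`. -/
lemma card_mul_pow_le_of_separated [FiniteDimensional ℝ E] {η : ℝ} (hη : 0 < η)
    {s : Finset E} (hs : ∀ x ∈ s, ‖x‖ ≤ 1)
    (hsep : ∀ x ∈ s, ∀ y ∈ s, x ≠ y → 2 * η ≤ dist x y) :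
    (s.card : ℝ) * η ^ finrank ℝ E ≤ (1 + η) ^ finrank ℝ E := by
  borelize E
  let μ : Measure E := Measure.addHaar
  have hdisj : Set.PairwiseDisjoint (s : Set E) fun c => ball c η := by
    intro c hc d hd hcd
    exact ball_disjoint_ball (by linarith [hsep c hc d hd hcd])
  have hsub : ⋃ c ∈ s, ball c η ⊆ ball (0 : E) (1 + η) := by
    refine iUnion₂_subset fun x hx => ball_subset_ball' ?_
    rw [dist_zero_right]
    linarith [hs x hx]
  have h1 := measureReal_mono (μ := μ) hsub measure_ball_lt_top.ne
  rw [measureReal_biUnion_finset hdisj (fun _ _ => measurableSet_ball)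
    (fun _ _ => measure_ball_lt_top.ne)] at h1
  have hball : ∀ (y : E) {t : ℝ}, 0 < t →
      μ.real (ball y t) = t ^ finrank ℝ E * μ.real (ball 0 1) := fun y t ht => by
    rw [measureReal_def, Measure.addHaar_ball_of_pos μ y ht, ENNReal.toReal_mul,
      ENNReal.toReal_ofReal (by positivity), measureReal_def]
  simp only [hball _ hη, hball _ (show 0 < 1 + η by linarith), Finset.sum_const, nsmul_eq_mul,
    ← mul_assoc] at h1
  refine le_of_mul_le_mul_right h1 ?_
  exact ENNReal.toReal_pos (measure_ball_pos _ _ zero_lt_one).ne' measure_ball_lt_top.ne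

/-- A `2 * η`-separated set of maximal cardinality is a net, since any uncovered point could be
added. -/
lemma exists_sphere_net [FiniteDimensional ℝ E] {η : ℝ} (hη : 0 < η) :
    ∃ s : Finset E, (∀ x ∈ s, ‖x‖ = 1) ∧
      (s.card : ℝ) * η ^ finrank ℝ E ≤ (1 + η) ^ finrank ℝ E ∧
      ∀ x : E, ‖x‖ = 1 → ∃ y ∈ s, dist x y ≤ 2 * η := by
  classical
  let S : Set ℕ := {n | ∃ s : Finset E, s.card = n ∧ (∀ x ∈ s, ‖x‖ = 1) ∧
    ∀ x ∈ s, ∀ y ∈ s, x ≠ y → 2 * η ≤ dist x y}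
  have hne : S.Nonempty := ⟨0, ∅, by simp⟩
  have hbdd : BddAbove S := by
    refine ⟨⌊(1 + η) ^ finrank ℝ E / η ^ finrank ℝ E⌋₊, ?_⟩
    rintro _ ⟨s, rfl, h1, h2⟩
    refine Nat.le_floor ?_
    rw [le_div_iff₀ (by positivity)]
    exact card_mul_pow_le_of_separated hη (fun x hx => (h1 x hx).le) h2
  obtain ⟨s, hcard, h1, h2⟩ := Nat.sSup_mem hne hbdd
  refine ⟨s, h1, card_mul_pow_le_of_separated hη (fun x hx => (h1 x hx).le) h2, fun x hx => ?_⟩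
  by_contra! hcon
  have hxs : x ∉ s := fun h => by
    have := hcon x h
    rw [dist_self] at this
    linarith
  have hmem : s.card + 1 ∈ S := by
    refine ⟨insert x s, Finset.card_insert_of_notMem hxs, ?_, ?_⟩
    · simpa using ⟨hx, h1⟩
    · intro y hy z hz hyz
      rcases Finset.mem_insert.1 hy with rfl | hy' <;> rcases Finset.mem_insert.1 hz with rfl | hz'
      · exact absurd rfl hyz
      · exact (hcon z hz').le
      · rw [dist_comm]; exact (hcon y hy').le
      · exact h2 y hy' z hz' hyz
  have := le_csSup hbdd hmem
  omega

end Geometry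

/-! ### Greedy choice of hitting points. -/

section Greedy

variable {Ω ι : Type*} [MeasurableSpace Ω] (μ : Measure Ω) [IsProbabilityMeasure μ]

open Classical in
-- Averaging: a random point lies in at least `p * U.card` of the sets in expectation.
lemma exists_mul_card_le_card_filter_mem {A : ι → Set Ω} (hA : ∀ i, MeasurableSet (A i)) {p : ℝ}
    (U : Finset ι) (hp : ∀ i ∈ U, p ≤ μ.real (A i)) :
    ∃ c, p * U.card ≤ (U.filter fun i => c ∈ A i).card := by
  have hint : ∀ i ∈ U, Integrable ((A i).indicator fun _ => (1 : ℝ)) μ := fun i _ =>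
    (integrable_const _).indicator (hA i)
  obtain ⟨c, hc⟩ := exists_integral_le (integrable_finsetSum U hint)
  refine ⟨c, ?_⟩
  rw [integral_finsetSum U hint] at hc
  simp only [integral_indicator_const _ (hA _), smul_eq_mul, mul_one] at hc
  calc p * U.card = ∑ i ∈ U, p := by simp [mul_comm]
    _ ≤ ∑ i ∈ U, μ.real (A i) := Finset.sum_le_sum hp
    _ ≤ ∑ i ∈ U, (A i).indicator (fun _ => (1 : ℝ)) c := hc
    _ = _ := by simp [Set.indicator_apply, Finset.sum_boole]

open Classical in
-- Each new point hits at least a share `p` of the sets still missed.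
lemma exists_card_filter_forall_notMem_le {A : ι → Set Ω} (hA : ∀ i, MeasurableSet (A i)) {p : ℝ}
    (hp1 : p ≤ 1) (U : Finset ι) (hp : ∀ i ∈ U, p ≤ μ.real (A i)) (n : ℕ) :
    ∃ C : Finset Ω, C.card ≤ n ∧
      ((U.filter fun i => ∀ c ∈ C, c ∉ A i).card : ℝ) ≤ (1 - p) ^ n * U.card := by
  induction n with
  | zero => exact ⟨∅, by simp⟩
  | succ n ih =>
    obtain ⟨C, hC, hle⟩ := ih
    set V := U.filter fun i => ∀ c ∈ C, c ∉ A i with hV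
    obtain ⟨c, hc⟩ := exists_mul_card_le_card_filter_mem μ hA V
      fun i hi => hp i (Finset.mem_filter.1 hi).1
    refine ⟨insert c C, (Finset.card_insert_le _ _).trans (by omega), ?_⟩
    have heq : (U.filter fun i => ∀ c' ∈ insert c C, c' ∉ A i) = V.filter fun i => c ∉ A i := by
      ext i
      simp only [hV, Finset.mem_filter, Finset.mem_insert, forall_eq_or_imp]
      tauto
    have hsum : ((V.filter fun i => c ∈ A i).card : ℝ) + (V.filter fun i => c ∉ A i).card =
        V.card := by
      exact_mod_cast Finset.card_filter_add_card_filter_not (s := V) fun i => c ∈ A i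
    rw [heq, pow_succ']
    nlinarith

end Greedy

/-! ### Covering the sphere economically. -/

section Covering

open Module Metric Set

/-- A maximal separated set in the unit sphere is covered greedily by `n` balls of radius
`(1 + θ) * r`, up to few points. -/
lemma exists_sphere_cover_card_le {E : Type*} [NormedAddCommGroup E] [InnerProductSpace ℝ E]
    [FiniteDimensional ℝ E] {r θ : ℝ} (hr : 0 < r) (hr1 : r < 1) (hθ : 0 < θ) (hθ1 : θ ≤ 1)
    (n : ℕ) :
    ∃ s : Finset E,
      (s.card : ℝ) ≤ n + (1 - θ * (r / (1 + θ)) ^ finrank ℝ E) ^ n *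
        ((1 + θ * r) / (θ * r)) ^ finrank ℝ E ∧
      ∀ x : E, ‖x‖ = 1 → ∃ c ∈ s, dist x c ≤ (1 + 3 * θ) * r := by
  classical
  borelize E
  set d := finrank ℝ E
  set p := θ * (r / (1 + θ)) ^ d with hp
  have hp1 : p ≤ 1 := by
    refine mul_le_one₀ hθ1 (by positivity) (pow_le_one₀ (by positivity) ?_)
    rw [div_le_one (by positivity)]
    linarith
  let ν : Measure E := Measure.addHaar
  set ρ := √(1 - r ^ 2) with hρdef
  have hr2 : 0 < 1 - r ^ 2 := by nlinarith
  have hρ : 0 < ρ := Real.sqrt_pos.2 hr2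
  have hrρ : r ^ 2 + ρ ^ 2 = 1 := by rw [hρdef, Real.sq_sqrt hr2.le]; ring
  set D : Set E := closedBall 0 ((1 + θ) * ρ)
  have hV : 0 < ν.real (closedBall 0 1) :=
    ENNReal.toReal_pos (measure_closedBall_pos _ _ zero_lt_one).ne' measure_closedBall_lt_top.ne
  have hνD : ν.real D = ((1 + θ) * ρ) ^ d * ν.real (closedBall 0 1) :=
    Measure.addHaar_real_closedBall' ν 0 (by positivity)
  have hD0 : ν D ≠ 0 := (measure_closedBall_pos _ _ (by positivity)).ne'
  let μ : Measure E := ProbabilityTheory.cond ν D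
  have : IsProbabilityMeasure μ := ProbabilityTheory.cond_isProbabilityMeasure_of_finite hD0
    measure_closedBall_lt_top.ne
  have hμ : ∀ x : E, ‖x‖ = 1 → p ≤ μ.real (closedBall x ((1 + θ) * r)) := fun x hx => by
    have h := measureReal_inter_closedBall_ge ν hx hr hρ hrρ hθ
    rw [measureReal_def, ProbabilityTheory.cond_apply measurableSet_closedBall, ENNReal.toReal_mul,
      ENNReal.toReal_inv, ← measureReal_def, ← measureReal_def, ← div_eq_inv_mul,
      le_div_iff₀ (by rw [hνD]; positivity), hνD]
    refine le_trans (le_of_eq ?_) h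
    rw [hp, div_pow, mul_pow, mul_pow]
    field_simp
    rfl
  -- The net has mesh `2 * θ * r`, so passing from it to the sphere enlarges `(1 + θ) * r` to `(1 +
  -- 3 * θ) * r`.
  obtain ⟨X, hX1, hXcard, hXnet⟩ := exists_sphere_net (E := E) (η := θ * r) (by positivity)
  obtain ⟨C, hC, hleft⟩ := exists_card_filter_forall_notMem_le μ
    (A := fun x : E => closedBall x ((1 + θ) * r)) (fun _ => measurableSet_closedBall) hp1 X
    (fun x hx => hμ x (hX1 x hx)) n
  set L := X.filter fun x => ∀ c ∈ C, c ∉ closedBall x ((1 + θ) * r)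
  refine ⟨C ∪ L, ?_, fun x hx => ?_⟩
  · have h1 : ((C ∪ L).card : ℝ) ≤ C.card + L.card := by exact_mod_cast Finset.card_union_le C L
    have h2 : (C.card : ℝ) ≤ n := by exact_mod_cast hC
    have h3 : (X.card : ℝ) ≤ ((1 + θ * r) / (θ * r)) ^ d := by
      rw [div_pow, le_div_iff₀ (by positivity)]
      exact hXcard
    have h4 : 0 ≤ (1 - p) ^ n := pow_nonneg (by linarith) n
    nlinarith [mul_le_mul_of_nonneg_left h3 h4]
  · obtain ⟨y, hyX, hxy⟩ := hXnet x hx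
    by_cases hy : y ∈ L
    · exact ⟨y, Finset.mem_union_right _ hy, hxy.trans (by nlinarith [mul_pos hθ hr])⟩
    · have : ∃ c ∈ C, c ∈ closedBall y ((1 + θ) * r) := by
        by_contra! hcon
        exact hy (Finset.mem_filter.2 ⟨hyX, hcon⟩)
      obtain ⟨c, hc, hcy⟩ := this
      refine ⟨c, Finset.mem_union_left _ hc, (dist_triangle x y c).trans ?_⟩
      rw [mem_closedBall, dist_comm] at hcy
      linarith

/-- The unit sphere of `ℝ^d` is covered by `O(d² log d) r⁻ᵈ` balls of radius `r`. -/
lemma exists_sphere_cover_card_le_logb {E : Type*} [NormedAddCommGroup E] [InnerProductSpace ℝ E]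
    [FiniteDimensional ℝ E] (hd : 3 ≤ finrank ℝ E) {r : ℝ} (hr : 0 < r) (hr1 : r < 1) :
    ∃ s : Finset E,
      (s.card : ℝ) ≤ 49 * (finrank ℝ E : ℝ) ^ 2 * Real.logb 2 (finrank ℝ E) *
        (r ^ finrank ℝ E)⁻¹ ∧
      ∀ x : E, ‖x‖ = 1 → ∃ c ∈ s, dist x c ≤ r := by
  set d := finrank ℝ E
  have hd3 : (3 : ℝ) ≤ d := by exact_mod_cast hd
  have hd0 : (0 : ℝ) < d := by linarith
  set θ : ℝ := 1 / (4 * d) with hθ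
  have hθ0 : 0 < θ := by positivity
  have hθd : 4 * d * θ = 1 := by rw [hθ]; field_simp
  have hθ1 : θ ≤ 1 := by nlinarith
  set r₀ : ℝ := r / (1 + 3 * θ) with hr₀
  have hr₀0 : 0 < r₀ := by positivity
  have hr₀r : (1 + 3 * θ) * r₀ = r := by rw [hr₀]; field_simp
  have hr₀1 : r₀ < 1 := by nlinarith
  set p : ℝ := θ * (r₀ / (1 + θ)) ^ d with hp
  have hp0 : 0 < p := by positivity
  have hp1 : p ≤ 1 := by
    refine mul_le_one₀ hθ1 (by positivity) (pow_le_one₀ (by positivity) ?_)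
    rw [div_le_one (by positivity)]
    linarith
  -- This `n` makes `exp (-(p * n)) ≤ θ ^ d`, which cancels the factor `θ⁻ᵈ` in the size of the net.
  set n : ℕ := ⌈d * Real.log (4 * d) / p⌉₊ with hn
  have hlog0 : 0 ≤ Real.log (4 * d) := Real.log_nonneg (by linarith)
  have hn1 : d * Real.log (4 * d) ≤ p * n := by
    have := Nat.le_ceil (d * Real.log (4 * d) / p)
    rw [div_le_iff₀ hp0] at this
    linarith
  have hn2 : (n : ℝ) ≤ d * Real.log (4 * d) / p + 1 := (Nat.ceil_lt_add_one (by positivity)).le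
  have hpow : (1 - p) ^ n ≤ θ ^ d := by
    calc (1 - p) ^ n ≤ Real.exp (-p) ^ n :=
          pow_le_pow_left₀ (by linarith) (by linarith [Real.add_one_le_exp (-p)]) n
      _ = Real.exp (-(p * n)) := by rw [← Real.exp_nat_mul]; ring_nf
      _ ≤ Real.exp (-(d * Real.log (4 * d))) := Real.exp_le_exp.2 (by linarith)
      _ = θ ^ d := by
        rw [← mul_neg, Real.exp_nat_mul, Real.exp_neg, Real.exp_log (by positivity), hθ, one_div]
  have hleft : (1 - p) ^ n * ((1 + θ * r₀) / (θ * r₀)) ^ d ≤ 1 / p := by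
    calc (1 - p) ^ n * ((1 + θ * r₀) / (θ * r₀)) ^ d
        ≤ θ ^ d * ((1 + θ * r₀) / (θ * r₀)) ^ d := by gcongr
      _ = ((1 + θ * r₀) / r₀) ^ d := by rw [← mul_pow]; congr 1; field_simp
      _ ≤ ((1 + θ) / r₀) ^ d := by gcongr; nlinarith
      _ = θ / p := by
        have h1 : (1 + θ) / r₀ * (r₀ / (1 + θ)) = 1 := by
          rw [div_mul_div_comm, mul_comm r₀]
          exact div_self (by positivity)
        rw [eq_div_iff hp0.ne', hp, mul_left_comm, ← mul_pow, h1, one_pow, mul_one]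
      _ ≤ 1 / p := by gcongr
  have hinv : 1 / p ≤ 12 * d * (r ^ d)⁻¹ := by
    have hexp : ((1 + θ) * (1 + 3 * θ)) ^ d ≤ 3 := by
      calc ((1 + θ) * (1 + 3 * θ)) ^ d ≤ (Real.exp θ * Real.exp (3 * θ)) ^ d := by
            gcongr <;> [linarith [Real.add_one_le_exp θ]; linarith [Real.add_one_le_exp (3 * θ)]]
        _ = Real.exp 1 := by
            rw [← Real.exp_add, ← Real.exp_nat_mul]
            congr 1
            linarith
        _ ≤ 3 := by linarith [Real.exp_one_lt_d9]
    have : 1 / p = 4 * d * ((1 + θ) * (1 + 3 * θ)) ^ d * (r ^ d)⁻¹ := by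
      rw [hp, ← hr₀r, div_pow, mul_pow, mul_pow,
        show 4 * (d : ℝ) = 1 / θ by rw [eq_div_iff hθ0.ne', hθd]]
      clear_value θ r₀
      field_simp
    rw [this, show 12 * (d : ℝ) = 4 * d * 3 by ring]
    gcongr
  have hrd : 1 ≤ (r ^ d)⁻¹ := by
    rw [one_le_inv₀ (by positivity)]
    exact pow_le_one₀ hr.le hr1.le
  have hlog3 : 1 ≤ Real.log d := by
    rw [Real.le_log_iff_exp_le hd0]
    linarith [Real.exp_one_lt_d9]
  have hlogb : Real.log d ≤ Real.logb 2 d := by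
    rw [Real.logb, le_div_iff₀ (Real.log_pos one_lt_two)]
    nlinarith [Real.log_two_lt_d9]
  have hlog4 : Real.log (4 * d) ≤ 3 * Real.logb 2 d := by
    have : Real.log (4 * d) ≤ Real.log ((d : ℝ) ^ 3) :=
      Real.log_le_log (by positivity) (by nlinarith [mul_pos hd0 hd0])
    rw [Real.log_pow] at this
    push_cast at this
    linarith
  obtain ⟨s, hs, hcov⟩ := exists_sphere_cover_card_le (E := E) hr₀0 hr₀1 hθ0 hθ1 n
  refine ⟨s, hs.trans ?_, by rwa [hr₀r] at hcov⟩
  set l := Real.logb 2 d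
  set R := (r ^ d)⁻¹
  have hl0 : 0 ≤ l := by linarith
  calc (n : ℝ) + (1 - p) ^ n * ((1 + θ * r₀) / (θ * r₀)) ^ d
      ≤ (d * Real.log (4 * d) / p + 1) + 1 / p := add_le_add hn2 hleft
    _ = (d * Real.log (4 * d) + 1) * (1 / p) + 1 := by ring
    _ ≤ (d * (3 * l) + 1) * (12 * d * R) + 1 * R :=
        add_le_add (by gcongr) (by rwa [one_mul])
    _ = (36 * d ^ 2 * l + 12 * d + 1) * R := by ring
    _ ≤ 49 * d ^ 2 * l * R := by
      gcongr
      nlinarith [mul_le_mul_of_nonneg_left (hlog3.trans hlogb) (sq_nonneg (d : ℝ))]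

end Covering

/-! ### From covers to compressors, and the asymptotics. -/

namespace SphereCompressor

instance (d : ℕ) : Nonempty (SphereCompressor d) :=
  ⟨{ Ω := Unit
     mΩ := ⊤
     P := Measure.dirac ()
     isProbabilityMeasure := inferInstance
     encode := fun _ _ => []
     decode := fun _ => 0
     measurableSet_encode := fun _ _ => MeasurableSet.of_discrete }⟩

/-- A covering of the unit sphere by at most `2 ^ b` balls of radius `r` gives a deterministic
compressor with codewords of length `b`. -/
lemma exists_of_cover {d : ℕ} (hd : 0 < d) {r : ℝ} {b : ℕ}
    {s : Finset (EuclideanSpace ℝ (Fin d))} (hs : s.card ≤ 2 ^ b)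
    (hcov : ∀ x : EuclideanSpace ℝ (Fin d), ‖x‖ = 1 → ∃ c ∈ s, dist x c ≤ r) :
    ∃ C : SphereCompressor d, C.IsContractive (r ^ 2) ∧ C.worstCaseBits = (b : ℕ∞) := by
  have hcard : Fintype.card s ≤ Fintype.card (List.Vector Bool b) := by simpa using hs
  obtain ⟨e⟩ := Function.Embedding.nonempty_of_card_le hcard
  choose c hcs hc using fun x : UnitSphere d => hcov x (by simp)
  let enc : s → List Bool := fun y => (e y).toList
  have henc : Function.Injective enc := fun y z h => e.injective (Subtype.ext h)
  let C : SphereCompressor d :=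
    { Ω := Unit
      mΩ := ⊤
      P := Measure.dirac ()
      isProbabilityMeasure := inferInstance
      encode := fun x _ => enc ⟨c x, hcs x⟩
      -- The value 0 on words outside the range of `enc` is never used.
      decode := Function.extend enc Subtype.val 0
      measurableSet_encode := fun _ _ => MeasurableSet.of_discrete }
  have hfun : ∀ x ω, C.toFun x ω = c x := fun x ω => henc.extend_apply _ _ _
  refine ⟨C, fun x => ?_, ?_⟩
  · simp only [hfun]
    have hx : ‖(x : EuclideanSpace ℝ (Fin d))‖ = 1 := by simp
    let := C.mΩ
    have := C.isProbabilityMeasure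
    refine ⟨integrable_const _, ?_⟩
    rw [integral_const, probReal_univ, one_smul, hx, one_pow, mul_one, norm_sub_rev,
      ← dist_eq_norm]
    exact pow_le_pow_left₀ dist_nonneg (hc x) 2
  · have : Nontrivial (EuclideanSpace ℝ (Fin d)) :=
      have : Nonempty (Fin d) := ⟨⟨0, hd⟩⟩
      inferInstance
    have hne : Nonempty (UnitSphere d) := (NormedSpace.sphere_nonempty.2 zero_le_one).to_subtype
    have hlen : ∀ x ω, (C.encode x ω).length = b := fun x ω => (e _).2
    have : Nonempty C.Ω := ⟨()⟩
    simp only [worstCaseBits, hlen, ciSup_const]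

end SphereCompressor

/-- As `1 ≤ logb 2 d ≤ d` for `d ≥ 2`, the expression lies between 1 and a product of powers of
`1600 ^ (1 / d)` and `d ^ (1 / d)`. -/
lemma tendsto_const_mul_sq_mul_logb_rpow_two_div :
    Filter.Tendsto (fun d : ℕ => (1600 * (d : ℝ) ^ 2 * Real.logb 2 (d : ℝ)) ^ ((2 : ℝ) / (d : ℝ)))
      Filter.atTop (nhds 1) := by
  have hlim : Filter.Tendsto
      (fun x : ℝ => ((1600 : ℝ) ^ (1 / x)) ^ 2 * (x ^ (1 / x)) ^ 6) Filter.atTop (nhds 1) := by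
    have h0 : Filter.Tendsto (fun x : ℝ => 1 / x) Filter.atTop (nhds 0) := by
      simpa using tendsto_inv_atTop_zero (𝕜 := ℝ)
    have h1 := ((Real.continuous_const_rpow (show (1600 : ℝ) ≠ 0 by norm_num)).tendsto 0 |>.comp h0).pow 2
    simpa [Function.comp_def] using h1.mul (tendsto_rpow_div.pow 6)
  have hcomp := hlim.comp (tendsto_natCast_atTop_atTop (R := ℝ))
  refine tendsto_of_tendsto_of_tendsto_of_le_of_le' tendsto_const_nhds hcomp ?_ ?_
  all_goals
    filter_upwards [Filter.eventually_ge_atTop 2] with d hd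
    have hd2 : (2 : ℝ) ≤ d := by exact_mod_cast hd
    have hl : 1 ≤ Real.logb 2 d := by
      rw [Real.le_logb_iff_rpow_le one_lt_two (by linarith)]
      simpa using hd2
  · refine Real.one_le_rpow ?_ (by positivity)
    nlinarith [mul_le_mul_of_nonneg_left hl (sq_nonneg (d : ℝ))]
  · have hl2 : Real.logb 2 d ≤ d := by
      rw [Real.logb_le_iff_le_rpow one_lt_two (by linarith), Real.rpow_natCast]
      exact_mod_cast Nat.lt_two_pow_self.le
    calc (1600 * (d : ℝ) ^ 2 * Real.logb 2 (d : ℝ)) ^ ((2 : ℝ) / (d : ℝ))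
        ≤ (1600 * (d : ℝ) ^ 2 * d) ^ ((2 : ℝ) / (d : ℝ)) := by gcongr
      _ = ((1600 * (d : ℝ) ^ 3) ^ (1 / (d : ℝ))) ^ 2 := by
        rw [← Real.rpow_mul_natCast (by positivity)]
        congr 1
        · ring
        · push_cast; ring
      _ = _ := by
        rw [Real.mul_rpow (by positivity) (by positivity), ← Real.rpow_natCast_mul (by positivity),
          mul_comm ((3 : ℕ) : ℝ), Real.rpow_mul_natCast (by positivity), mul_pow, ← pow_mul]
        rfl

lemma exists_compressor (α : ℝ) (hα0 : 0 < α) (hα1 : α < 1) {d : ℕ} (hd : 3 ≤ d) :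
    ∃ (C : SphereCompressor d) (b : ℕ),
      C.IsContractive α ∧ C.worstCaseBits = (b : ℕ∞) ∧
      α * (4 : ℝ) ^ ((b : ℝ) / (d : ℝ)) ≤
        (1600 * (d : ℝ) ^ 2 * Real.logb 2 (d : ℝ)) ^ ((2 : ℝ) / (d : ℝ)) := by
  have hd3 : (3 : ℝ) ≤ d := by exact_mod_cast hd
  have hd0 : (0 : ℝ) < d := by linarith
  set r := √α with hr
  have hr0 : 0 < r := Real.sqrt_pos.2 hα0
  have hrsq : r ^ 2 = α := Real.sq_sqrt hα0.le
  have hr1 : r < 1 := by nlinarith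
  have hfin : Module.finrank ℝ (EuclideanSpace ℝ (Fin d)) = d := finrank_euclideanSpace_fin
  obtain ⟨s, hs, hcov⟩ := exists_sphere_cover_card_le_logb (E := EuclideanSpace ℝ (Fin d))
    (by rwa [hfin]) hr0 hr1
  rw [hfin] at hs
  set K := (d : ℝ) ^ 2 * Real.logb 2 d with hK
  have hl : 1 ≤ Real.logb 2 d := by
    rw [Real.le_logb_iff_rpow_le one_lt_two hd0, Real.rpow_one]
    linarith
  have hK1 : 1 ≤ K := by nlinarith
  have hR : 1 ≤ (r ^ d)⁻¹ := by
    rw [one_le_inv₀ (by positivity)]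
    exact pow_le_one₀ hr0.le hr1.le
  have hKR : 1 ≤ K * (r ^ d)⁻¹ := one_le_mul_of_one_le_of_one_le hK1 hR
  -- Rounding to a power of 2 loses at most a factor 2, so `2 ^ b` exceeds `800 * (K * (r ^ d)⁻¹)`,
  -- well above the 49 needed.
  obtain ⟨b, hb1, hb2⟩ := exists_nat_pow_near
    (show 1 ≤ 1600 * (K * (r ^ d)⁻¹) by linarith) (one_lt_two (α := ℝ))
  have hcard : s.card ≤ 2 ^ b := by
    have : (s.card : ℝ) ≤ 2 ^ b := by
      rw [pow_succ] at hb2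
      have : 49 * (d : ℝ) ^ 2 * Real.logb 2 d * (r ^ d)⁻¹ = 49 * (K * (r ^ d)⁻¹) := by
        rw [hK]; ring
      linarith
    exact_mod_cast this
  obtain ⟨C, hC, hbits⟩ := SphereCompressor.exists_of_cover (by omega) hcard hcov
  refine ⟨C, b, hrsq ▸ hC, hbits, ?_⟩
  have h4 : (4 : ℝ) ^ ((b : ℝ) / d) = ((2 : ℝ) ^ b) ^ ((2 : ℝ) / d) := by
    rw [show (4 : ℝ) = 2 ^ (2 : ℝ) by norm_num, ← Real.rpow_natCast, ← Real.rpow_mul zero_le_two,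
      ← Real.rpow_mul zero_le_two]
    congr 1
    ring
  have hα : α = (r ^ d) ^ ((2 : ℝ) / d) := by
    rw [← Real.rpow_natCast, ← Real.rpow_mul hr0.le, mul_div_cancel₀ _ hd0.ne', Real.rpow_two, hrsq]
  calc α * (4 : ℝ) ^ ((b : ℝ) / d)
      = (r ^ d * 2 ^ b) ^ ((2 : ℝ) / d) := by
        rw [Real.mul_rpow (by positivity) (by positivity), ← hα, h4]
    _ ≤ (r ^ d * (1600 * (K * (r ^ d)⁻¹))) ^ ((2 : ℝ) / d) := by gcongr
    _ = (1600 * (d : ℝ) ^ 2 * Real.logb 2 d) ^ ((2 : ℝ) / d) := by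
        congr 1
        rw [hK]
        field_simp

theorem mainTheorem4 (α : ℝ) (hα0 : 0 < α) (hα1 : α < 1) :
    ∃ (C : ∀ d : ℕ, SphereCompressor d) (b : ℕ → ℕ),
      (∀ d : ℕ, 3 ≤ d →
        (C d).IsContractive α ∧
        (C d).worstCaseBits = (b d : ℕ∞) ∧
        α * (4 : ℝ) ^ ((b d : ℝ) / (d : ℝ)) ≤
          (1600 * (d : ℝ) ^ 2 * Real.logb 2 (d : ℝ)) ^ ((2 : ℝ) / (d : ℝ))) ∧
      (∀ ε : ℝ, 0 < ε → ∃ d₀ : ℕ, ∀ d : ℕ, d₀ ≤ d →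
        α * (4 : ℝ) ^ ((b d : ℝ) / (d : ℝ)) < 1 + ε) := by
  have hex : ∀ d : ℕ, ∃ (C : SphereCompressor d) (b : ℕ), 3 ≤ d →
      C.IsContractive α ∧ C.worstCaseBits = (b : ℕ∞) ∧
      α * (4 : ℝ) ^ ((b : ℝ) / (d : ℝ)) ≤
        (1600 * (d : ℝ) ^ 2 * Real.logb 2 (d : ℝ)) ^ ((2 : ℝ) / (d : ℝ)) := fun d => by
    by_cases hd : 3 ≤ d
    · obtain ⟨C, b, h⟩ := exists_compressor α hα0 hα1 hd
      exact ⟨C, b, fun _ => h⟩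
    · exact ⟨Classical.arbitrary _, 0, fun h => absurd h hd⟩
  choose C b h using hex
  refine ⟨C, b, h, fun ε hε => ?_⟩
  obtain ⟨d₀, hd₀⟩ := Filter.eventually_atTop.1
    (tendsto_const_mul_sq_mul_logb_rpow_two_div.eventually_lt_const (show 1 < 1 + ε by linarith))
  exact ⟨max 3 d₀, fun d hd => (h d (le_of_max_le_left hd)).2.2.trans_lt
    (hd₀ d (le_of_max_le_right hd))⟩
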